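/- \textbf{The model.} Start with the graph consisting of the single vertex $0$. After $n$ steps the vertex set is $\{0,1,\dots,n\}$. In step $n+1$ two (not necessarily different) vertices $u,v\in\{0,\dots,n\}$ are chosen independently and uniformly at random, independently of all earlier steps; a new vertex $w=n+1$ is added and connected to $u$ and to all neighbours of $u$ (duplication). In \emph{version 1}, all edges of $v$ are then deleted, except that the edge $vw$, if present, is kept. In \emph{version 2}, all edges of $v$ are deleted without exception. Couple the two versions by using the same $u,v$ in every step, and call an edge of version 1 \emph{red} if it is not an edge of version 2 at the same time. Vertices are coloured as follows; at the start the only vertex is black. In the duplication part of a step, the new vertex $w$ becomes red if $u$ is red, and black otherwise. Then, in the erasure part, if $v$ and $w$ are joined by an edge in version 1 (this edge is saved in version 1 and deleted in version 2, so it is red after the step), both $v$ and $w$ become red; otherwise $v$ has lost all its edges and becomes black. All other vertices keep their colour. \textbf{Proposition.} Let $S_n$ be the number of all edges (red or not) in version 1 after $n$ steps, and let $Z_n$ be the number of red vertices after $n$ steps. Then, almost surely, as $n\to\infty$, \[ S_n\sim n ,\qquad\text{and}\qquad Z_n=O\bigl(\log^{1+\varepsilon} n\bigr)\ \text{ for every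 } \varepsilon>0 . \] -/

import Mathlib

open Filter Asymptotics MeasureTheory ProbabilityTheory

namespace DupGraph

/-- The two old vertices selected in each step. After `n` steps the vertices are `0, …, n`;
in step `n + 1` the vertex `(c n).1` is duplicated, then `(c n).2` is selected for erasure,
and `n + 1` is the new vertex. -/
abbrev Choices : Type := (n : ℕ) → Fin (n + 1) × Fin (n + 1)

/-- Duplication: the vertex `a` gets connected to `u` and to all neighbours of `u`. -/
def duplicate (G : SimpleGraph ℕ) (u a : ℕ) : SimpleGraph ℕ :=
  G ⊔ SimpleGraph.fromRel (fun x y => x = a ∧ (y = u ∨ G.Adj u y))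

/-- The graph of version 1 after `n` steps: in the erasure part all edges of the vertex
`(c n).2` are deleted, except a possible edge to the new vertex `n + 1`. -/
def version1 (c : Choices) : ℕ → SimpleGraph ℕ
  | 0 => ⊥
  | n + 1 =>
    let G := duplicate (version1 c n) (c n).1 (n + 1)
    G.deleteEdges (G.incidenceSet (c n).2 \ {s(((c n).2 : ℕ), n + 1)})

/-- The graph of version 2 after `n` steps: in the erasure part all edges of the vertex
`(c n).2` are deleted without exceptions. -/
def version2 (c : Choices) : ℕ → SimpleGraph ℕ
  | 0 => ⊥
  | n + 1 =>
    let H := duplicate (version2 c n) (c n).1 (n + 1)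
    H.deleteEdges (H.incidenceSet (c n).2)

/-- The red edges after `n` steps: the edges that are present in version 1, but not in
version 2 run with the same selected vertices. -/
def redEdges (c : Choices) (n : ℕ) : SimpleGraph ℕ := version1 c n \ version2 c n

open Classical in
/-- The red vertices after `n` steps. In the duplication part the new vertex becomes red if and
only if the duplicated vertex is red. Then, if the new vertex and the vertex selected for erasure
are joined by a (saved, hence red) edge, both of them become red; otherwise the vertex selected
for erasure has lost all its edges and becomes black. -/
noncomputable def redVertices (c : Choices) : ℕ → Finset ℕ
  | 0 => ∅
  | n + 1 =>
    let R := if ((c n).1 : ℕ) ∈ redVertices c n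
      then insert (n + 1) (redVertices c n) else redVertices c n
    if (redEdges c (n + 1)).Adj (c n).2 (n + 1)
      then insert ((c n).2 : ℕ) (insert (n + 1) R) else R.erase (c n).2

/-- The number `S n` of edges (red or not) of version 1 after `n` steps. -/
noncomputable def numEdges (c : Choices) (n : ℕ) : ℕ := (version1 c n).edgeSet.ncard

/-- The number `Z n` of red vertices after `n` steps. -/
noncomputable def numRed (c : Choices) (n : ℕ) : ℕ := (redVertices c n).card

/-- In all steps the two old vertices are selected uniformly at random, with replacement,
independently of each other and of the other steps. -/
structure IsUniformChoice {Ω : Type*} [MeasurableSpace Ω] (μ : Measure Ω)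
    (c : (n : ℕ) → Ω → Fin (n + 1) × Fin (n + 1)) : Prop where
  measurable : ∀ n, Measurable (c n)
  law : ∀ n, μ.map (c n) =
    (uniformOn (Set.univ : Set (Fin (n + 1)))).prod (uniformOn (Set.univ : Set (Fin (n + 1))))
  indep : iIndepFun c μ

/-- All edges of version 1 after `n` steps join vertices among `0, …, n`. -/
theorem le_of_version1_adj (c : Choices) (n : ℕ) :
    ∀ x y : ℕ, (version1 c n).Adj x y → x ≤ n ∧ y ≤ n := by
  induction n with
  | zero => intro x y h; simp [version1] at h
  | succ n ih =>
    intro x y h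
    have hu := (c n).1.isLt
    have h' : (duplicate (version1 c n) (c n).1 (n + 1)).Adj x y := by
      simp only [version1] at h
      exact (SimpleGraph.deleteEdges_adj.1 h).1
    simp only [duplicate, SimpleGraph.sup_adj, SimpleGraph.fromRel_adj] at h'
    rcases h' with h' | ⟨-, ⟨rfl, rfl | h'⟩ | ⟨rfl, rfl | h'⟩⟩
    · have := ih _ _ h'; omega
    · omega
    · have := ih _ _ h'; omega
    · omega
    · have := ih _ _ h'; omega

/-- The edge set of version 1 is finite, so that `numEdges` is its true cardinality. -/
theorem finite_edgeSet_version1 (c : Choices) (n : ℕ) : (version1 c n).edgeSet.Finite := by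
  refine (((Set.finite_Iic n).prod (Set.finite_Iic n)).image (fun p => s(p.1, p.2))).subset ?_
  intro e
  induction e with
  | h x y =>
    intro h
    exact ⟨(x, y), le_of_version1_adj c n x y h, rfl⟩

end DupGraph

/-!
Duplicating `u` adds `deg u + 1` edges and erasing `v` removes `deg v` edges, because the edge from
`v` to its copy, if present, is kept. So `S` changes in one step by `1 + deg u - deg v`. As `u` and
`v` have the same law, the mean of `S n` is `n` and `(S n - n) ^ 2` grows in mean by at most
`4 Q n / (n + 1)`, where `Q n` is the sum of the squared degrees. The quadratic parts of the changes
of `Q` under duplication and erasure cancel in mean as well, and linear terms remain, so that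
`E (Q n) ≤ 14 n`. The Robbins–Siegmund theorem, applied to `(S n - n) ^ 2 / (n + 1) ^ (3 / 2)`,
yields `(S n - n) ^ 2 = O (n ^ (3 / 2))` almost surely, hence `S n ∼ n`.

Similarly, duplicating a red vertex and erasing a red vertex cancel in the conditional mean of `Z`.
Additional red vertices, at most two per step, appear only if `v` is `u` or a neighbour of `u`,
which has conditional probability `(n + 1 + 2 S n) / (n + 1) ^ 2`. So the drift of `Z n` has mean at
most `6 / (n + 1)`, and `∑ 1 / (n log ^ (1 + δ) n) < ∞` together with the Robbins–Siegmund theorem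
gives `Z n = O (log ^ (1 + δ) n)` for all `δ > 0`.
-/

section Asymptotics

theorem isEquivalent_natCast_of_isBigO_sq_sub {S : ℕ → ℝ} {p : ℝ} (hp : p < 2)
    (hS : (fun n ↦ (S n - n) ^ 2) =O[atTop] fun n : ℕ ↦ ((n : ℝ) + 1) ^ p) :
    S ~[atTop] fun n ↦ (n : ℝ) := by
  have hrpow : (fun x : ℝ ↦ x ^ p) =o[atTop] fun x ↦ x ^ (2 : ℝ) := by
    refine isLittleO_of_tendsto' ?_ ((tendsto_rpow_neg_atTop (sub_pos.2 hp)).congr' ?_)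
    · filter_upwards [eventually_gt_atTop 0] with x hx h using
        absurd h (Real.rpow_pos_of_pos hx _).ne'
    · filter_upwards [eventually_gt_atTop 0] with x hx
      rw [← Real.rpow_sub hx, neg_sub]
  have hsucc : (fun n : ℕ ↦ (n : ℝ) + 1) =O[atTop] fun n : ℕ ↦ (n : ℝ) := by
    refine .of_bound 2 ((eventually_ge_atTop 1).mono fun n hn ↦ ?_)
    have hn' : (1 : ℝ) ≤ n := mod_cast hn
    rw [Real.norm_of_nonneg (by positivity), Real.norm_of_nonneg (by positivity)]
    linarith
  have hlim : Tendsto (fun n : ℕ ↦ (n : ℝ) + 1) atTop atTop :=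
    tendsto_atTop_add_const_right _ _ tendsto_natCast_atTop_atTop
  refine IsLittleO.of_pow (n := 2) ?_ two_ne_zero
  refine (hS.trans_isLittleO (hrpow.comp_tendsto hlim)).trans_isBigO ?_
  simpa only [Function.comp_def, Real.rpow_two, Pi.pow_def] using hsucc.pow 2

theorem log_natCast_add_pos {a : ℝ} (ha : 1 < a) (n : ℕ) : 0 < Real.log (n + a) :=
  Real.log_pos (by linarith [n.cast_nonneg (α := ℝ)])

theorem summable_one_div_mul_log_rpow {p : ℝ} (hp : 1 < p) :
    Summable fun n : ℕ ↦ 1 / ((n : ℝ) * Real.log (n + 2) ^ p) := by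
  refine (summable_condensed_iff_of_nonneg (fun n ↦ ?_) fun m n hm hmn ↦ ?_).1 ?_
  · have := log_natCast_add_pos one_lt_two n
    positivity
  · have := log_natCast_add_pos one_lt_two m
    have : (0 : ℝ) < m := mod_cast hm
    gcongr
  · have hpow : Summable fun k : ℕ ↦ 1 / (k * Real.log 2) ^ p := by
      refine ((Real.summable_one_div_nat_rpow.2 hp).mul_left (1 / Real.log 2 ^ p)).congr fun k ↦ ?_
      rw [Real.mul_rpow k.cast_nonneg (Real.log_nonneg one_le_two), ← one_div_mul_one_div_rev]
    refine hpow.of_norm_bounded_eventually_nat ((eventually_ge_atTop 1).mono fun k hk ↦ ?_)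
    have hlog_pos := log_natCast_add_pos one_lt_two (2 ^ k)
    have hlog : k * Real.log 2 ≤ Real.log ((2 ^ k : ℕ) + 2) := by
      rw [← Real.log_pow]
      exact Real.log_le_log (by positivity) (by push_cast; linarith)
    have : (0 : ℝ) < k * Real.log 2 :=
      mul_pos (mod_cast hk) (Real.log_pos one_lt_two)
    have hcancel : (2 : ℝ) ^ k * (1 / (((2 ^ k : ℕ) : ℝ) * Real.log ((2 ^ k : ℕ) + 2) ^ p)) =
        1 / Real.log ((2 ^ k : ℕ) + 2) ^ p := by
      push_cast
      field_simp
    rw [hcancel, Real.norm_of_nonneg (by positivity)]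
    gcongr

theorem isBigO_log_natCast_add_rpow (a : ℝ) {p q : ℝ} (hp : 0 ≤ p) (hpq : p ≤ q) :
    (fun n : ℕ ↦ Real.log (n + a) ^ p) =O[atTop] fun n : ℕ ↦ Real.log n ^ q := by
  have hnat : Tendsto (fun n : ℕ ↦ (n : ℝ)) atTop atTop := tendsto_natCast_atTop_atTop
  have hlog : Tendsto (fun n : ℕ ↦ Real.log n) atTop atTop := Real.tendsto_log_atTop.comp hnat
  have hshift : (fun n : ℕ ↦ (n : ℝ) + a) ~[atTop] fun n ↦ (n : ℝ) :=
    IsEquivalent.refl.add_isLittleO ((isLittleO_const_id_atTop a).comp_tendsto hnat)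
  have hlog_add := (hshift.log hnat).isBigO
  calc (fun n : ℕ ↦ Real.log (n + a) ^ p)
      =O[atTop] fun n : ℕ ↦ Real.log n ^ p := hlog_add.rpow hp (hlog.eventually_ge_atTop 0)
    _ =O[atTop] fun n : ℕ ↦ Real.log n ^ q := by
      refine .of_bound' ?_
      filter_upwards [hlog.eventually_ge_atTop 1] with n hn
      have : 0 ≤ Real.log n := zero_le_one.trans hn
      rw [Real.norm_of_nonneg (by positivity), Real.norm_of_nonneg (by positivity)]
      exact Real.rpow_le_rpow_of_exponent_le hn hpq

end Asymptotics

section ProductSpace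

variable {ι : Type*} {X : ι → Type*} [∀ i, MeasurableSpace (X i)]

theorem measurable_piFinset_iff {Ω : Type*} {_ : MeasurableSpace Ω} {s : Finset ι}
    {g : Ω → ∀ j, X j} :
    @Measurable _ _ _ (Filtration.piFinset s) g ↔ ∀ j ∈ s, Measurable fun ω ↦ g ω j := by
  refine measurable_comap_iff.trans (measurable_pi_iff.trans ?_)
  exact ⟨fun h j hj ↦ h ⟨j, hj⟩, fun h j ↦ h j j.2⟩

variable [DecidableEq ι]

theorem measurePreserving_update_infinitePi (ν : (i : ι) → Measure (X i))
    [∀ i, IsProbabilityMeasure (ν i)] (i : ι) :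
    MeasurePreserving (fun q : (∀ j, X j) × X i ↦ Function.update q.1 i q.2)
      ((Measure.infinitePi ν).prod (ν i)) (Measure.infinitePi ν) where
  measurable := measurable_update'
  map_eq := by
    refine Measure.eq_infinitePi ν fun s t ht ↦ ?_
    have hbox : (fun q : (∀ j, X j) × X i ↦ Function.update q.1 i q.2) ⁻¹' Set.pi s t =
        Set.pi ↑(s.erase i) t ×ˢ {x | i ∈ s → x ∈ t i} := by
      ext q
      simp only [Set.mem_preimage, Set.update_mem_pi_iff, Finset.coe_erase, Finset.mem_coe,
        Set.mem_prod, Set.mem_ofPred_eq]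
    rw [Measure.map_apply measurable_update' (.pi s.countable_toSet fun j _ ↦ ht j), hbox,
      Measure.prod_prod, Measure.infinitePi_pi ν fun j _ ↦ ht j]
    by_cases hi : i ∈ s
    · simp only [hi, true_imp_iff, Set.ofPred_mem_eq]
      exact Finset.prod_erase_mul s (fun j ↦ ν j (t j)) hi
    · simp only [hi, false_imp_iff, Set.ofPred_true, measure_univ, mul_one,
        Finset.erase_eq_of_notMem, not_false_eq_true]

theorem measurable_update_piFinset (s : Finset ι) (i : ι) :
    @Measurable _ _ ((Filtration.piFinset (X := X) s).prod inferInstance)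
      (Filtration.piFinset (X := X) (insert i s))
      (fun q : (∀ j, X j) × X i ↦ Function.update q.1 i q.2) := by
  refine measurable_piFinset_iff.2 fun j hj ↦ ?_
  rcases eq_or_ne j i with rfl | hji
  · simpa only [Function.update_self] using
      @measurable_snd _ _ (Filtration.piFinset (X := X) s) _
  · simp only [Function.update_of_ne hji]
    have hjs := Finset.mem_of_mem_insert_of_ne hj hji
    have heval := measurable_piFinset_iff.1
      (@measurable_id _ (Filtration.piFinset (X := X) s)) j hjs
    exact heval.comp (@measurable_fst _ _ (Filtration.piFinset (X := X) s) _)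

theorem condExp_piFinset_ae_eq_integral_update (ν : (i : ι) → Measure (X i))
    [∀ i, IsProbabilityMeasure (ν i)] {s : Finset ι} {i : ι} (hi : i ∉ s) {f : (∀ j, X j) → ℝ}
    (hf : StronglyMeasurable[Filtration.piFinset (insert i s)] f)
    (hint : Integrable f (Measure.infinitePi ν)) :
    (Measure.infinitePi ν)[f | Filtration.piFinset s] =ᵐ[Measure.infinitePi ν]
      fun c ↦ ∫ x, f (Function.update c i x) ∂ν i := by
  have hupd := measurePreserving_update_infinitePi ν i
  have hint' : Integrable (fun q : (∀ j, X j) × X i ↦ f (Function.update q.1 i q.2))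
      ((Measure.infinitePi ν).prod (ν i)) := hupd.integrable_comp_of_integrable hint
  have hmeas : StronglyMeasurable[Filtration.piFinset s]
      fun c ↦ ∫ x, f (Function.update c i x) ∂ν i :=
    @StronglyMeasurable.integral_prod_right' _ _ _ (Filtration.piFinset s) _ _ _ _ _ _
      (hf.comp_measurable (measurable_update_piFinset s i))
  refine (ae_eq_condExp_of_forall_setIntegral_eq (Filtration.piFinset.le s) hint
    (fun B _ _ ↦ hint'.integral_prod_left.integrableOn) (fun B hB _ ↦ ?_)
    hmeas.aestronglyMeasurable).symm
  have hBupd (q : (∀ j, X j) × X i) : Function.update q.1 i q.2 ∈ B ↔ q.1 ∈ B := by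
    obtain ⟨B', -, rfl⟩ := hB
    have : s.restrict (Function.update q.1 i q.2) = s.restrict q.1 :=
      funext fun j ↦ Function.update_of_ne (ne_of_mem_of_not_mem j.2 hi) _ _
    simp only [Set.mem_preimage, this]
  have hB' := Filtration.piFinset.le s B hB
  calc ∫ c in B, ∫ x, f (Function.update c i x) ∂ν i ∂Measure.infinitePi ν
      = ∫ q in B ×ˢ Set.univ, f (Function.update q.1 i q.2) ∂(Measure.infinitePi ν).prod (ν i) := by
        rw [setIntegral_prod _ hint'.integrableOn, Measure.restrict_univ]
    _ = ∫ q in (fun q : (∀ j, X j) × X i ↦ Function.update q.1 i q.2) ⁻¹' B,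
          f (Function.update q.1 i q.2) ∂(Measure.infinitePi ν).prod (ν i) := by
        congr 2
        ext q
        simp [hBupd]
    _ = ∫ c in B, f c ∂Measure.infinitePi ν := by
        rw [← setIntegral_map hB' (by rw [hupd.map_eq]; exact hint.aestronglyMeasurable)
          hupd.aemeasurable, hupd.map_eq]

end ProductSpace

section PastFiltration

variable {X : ℕ → Type*} [∀ n, MeasurableSpace (X n)]

/-- The filtration of a sequence space whose `n`-th σ-algebra is generated by the coordinates
`0, …, n - 1`, so that it is trivial at time `0`. -/
def pastFiltration (X : ℕ → Type*) [∀ n, MeasurableSpace (X n)] :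
    Filtration ℕ (MeasurableSpace.pi (X := X)) where
  seq n := Filtration.piFinset (Finset.range n)
  mono' _ _ hmn := Filtration.piFinset.mono (Finset.range_mono hmn)
  le' _ := Filtration.piFinset.le _

variable [∀ n, Finite (X n)] [∀ n, MeasurableSingletonClass (X n)] {f : (∀ n, X n) → ℝ} {n : ℕ}

theorem stronglyMeasurable_pastFiltration_of_dependsOn (hf : DependsOn f (Set.Iio n)) :
    StronglyMeasurable[pastFiltration X n] f := by
  rw [← Finset.coe_range] at hf
  obtain ⟨g, rfl⟩ := dependsOn_iff_exists_comp.1 hf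
  exact ((measurable_of_finite g).comp (comap_measurable _)).stronglyMeasurable

theorem integrable_of_dependsOn {μ : Measure (∀ n, X n)} [IsFiniteMeasure μ]
    (hf : DependsOn f (Set.Iio n)) : Integrable f μ := by
  rw [← Finset.coe_range] at hf
  obtain ⟨g, rfl⟩ := dependsOn_iff_exists_comp.1 hf
  exact Integrable.comp_measurable .of_finite (Finset.measurable_restrict _)

end PastFiltration

section RobbinsSiegmund

variable {Ω : Type*} {mΩ : MeasurableSpace Ω} {μ : Measure Ω}

theorem ae_summable_of_summable_integral {a : ℕ → Ω → ℝ} (ha : ∀ n, Integrable (a n) μ)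
    (ha0 : ∀ n, 0 ≤ᵐ[μ] a n) (hsum : Summable fun n ↦ ∫ ω, a n ω ∂μ) :
    ∀ᵐ ω ∂μ, Summable fun n ↦ a n ω := by
  have hnorm (n : ℕ) : eLpNorm (a n) 1 μ = ENNReal.ofReal (∫ ω, a n ω ∂μ) := by
    rw [eLpNorm_one_eq_lintegral_enorm, ← ofReal_integral_norm_eq_lintegral_enorm (ha n),
      integral_congr_ae ((ha0 n).mono fun _ h ↦ Real.norm_of_nonneg h)]
  have := summable_norm_of_tsum_eLpNorm_ne_top le_rfl (fun n ↦ (ha n).aestronglyMeasurable)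
    (by simpa only [hnorm] using hsum.tsum_ofReal_ne_top)
  filter_upwards [this] with ω hω using hω.of_norm

variable [IsFiniteMeasure μ]

theorem submartingale_sum_sub_of_condExp_succ_le {ℱ : Filtration ℕ mΩ} {Y a : ℕ → Ω → ℝ}
    (hY : StronglyAdapted ℱ Y) (ha : StronglyAdapted ℱ a)
    (hYint : ∀ n, Integrable (Y n) μ) (haint : ∀ n, Integrable (a n) μ)
    (hle : ∀ n, μ[Y (n + 1) | ℱ n] ≤ᵐ[μ] Y n + a n) :
    Submartingale (fun n ↦ ∑ k ∈ Finset.range n, a k - Y n) ℱ μ := by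
  have hAint (n : ℕ) : Integrable (∑ k ∈ Finset.range n, a k) μ :=
    integrable_finsetSum' _ fun k _ ↦ haint k
  have hA {m n : ℕ} (hmn : m ≤ n + 1) :
      StronglyMeasurable[ℱ n] (∑ k ∈ Finset.range m, a k) :=
    Finset.stronglyMeasurable_sum _ fun k hk ↦
      ha.stronglyMeasurable_le (Nat.lt_succ_iff.1 ((Finset.mem_range.1 hk).trans_le hmn))
  refine submartingale_nat (fun n ↦ (hA n.le_succ).sub (hY n))
    (fun n ↦ (hAint n).sub (hYint n)) fun n ↦ ?_
  filter_upwards [condExp_sub (hAint (n + 1)) (hYint (n + 1)) (ℱ n), hle n] with ω hsub hω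
  rw [hsub, Pi.sub_apply, Pi.sub_apply, condExp_of_stronglyMeasurable (ℱ.le n) (hA le_rfl)
    (hAint (n + 1)), Finset.sum_range_succ, Pi.add_apply]
  rw [Pi.add_apply] at hω
  linarith

theorem integral_norm_le_of_submartingale_of_le {ℱ : Filtration ℕ mΩ} {M : ℕ → Ω → ℝ}
    (hM : Submartingale M ℱ μ) {n : ℕ} {B : Ω → ℝ} (hB : Integrable B μ) (hB0 : 0 ≤ᵐ[μ] B)
    (hMB : M n ≤ᵐ[μ] B) : ∫ ω, ‖M n ω‖ ∂μ ≤ 2 * ∫ ω, B ω ∂μ - ∫ ω, M 0 ω ∂μ := by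
  have hmean : ∫ ω, M 0 ω ∂μ ≤ ∫ ω, M n ω ∂μ := by
    simpa only [setIntegral_univ] using hM.setIntegral_le n.zero_le .univ
  calc ∫ ω, ‖M n ω‖ ∂μ ≤ ∫ ω, (2 * B ω - M n ω) ∂μ := by
        refine integral_mono_ae (hM.integrable n).norm
          ((hB.const_mul 2).sub (hM.integrable n)) ?_
        filter_upwards [hB0, hMB] with ω hB0ω hMBω
        rw [Pi.zero_apply] at hB0ω
        exact abs_le.2 ⟨by linarith, by linarith⟩
    _ = 2 * ∫ ω, B ω ∂μ - ∫ ω, M n ω ∂μ := by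
        rw [integral_sub (hB.const_mul 2) (hM.integrable n), integral_const_mul]
    _ ≤ 2 * ∫ ω, B ω ∂μ - ∫ ω, M 0 ω ∂μ := sub_le_sub_left hmean _

/-- The Robbins–Siegmund almost supermartingale convergence theorem. -/
theorem exists_ae_tendsto_of_condExp_succ_le {ℱ : Filtration ℕ mΩ} {Y a : ℕ → Ω → ℝ}
    (hY : StronglyAdapted ℱ Y) (ha : StronglyAdapted ℱ a)
    (hYint : ∀ n, Integrable (Y n) μ) (haint : ∀ n, Integrable (a n) μ)
    (hY0 : ∀ n, 0 ≤ᵐ[μ] Y n) (ha0 : ∀ n, 0 ≤ᵐ[μ] a n)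
    (hle : ∀ n, μ[Y (n + 1) | ℱ n] ≤ᵐ[μ] Y n + a n)
    (hsum : Summable fun n ↦ ∫ ω, a n ω ∂μ) :
    ∀ᵐ ω ∂μ, ∃ l, Tendsto (fun n ↦ Y n ω) atTop (nhds l) := by
  set A : ℕ → Ω → ℝ := fun n ↦ ∑ k ∈ Finset.range n, a k with hA
  have hM := submartingale_sum_sub_of_condExp_succ_le hY ha hYint haint hle
  have hAint (n : ℕ) : Integrable (A n) μ := integrable_finsetSum' _ fun k _ ↦ haint k
  have hA_le (n : ℕ) : ∫ ω, A n ω ∂μ ≤ ∑' k, ∫ ω, a k ω ∂μ := by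
    simp only [hA, Finset.sum_apply]
    rw [integral_finsetSum _ fun k _ ↦ haint k]
    exact hsum.sum_le_tsum _ fun k _ ↦ integral_nonneg_of_ae (ha0 k)
  have hbdd (n : ℕ) : eLpNorm (A n - Y n) 1 μ ≤
      (2 * ∑' k, ∫ ω, a k ω ∂μ + ∫ ω, Y 0 ω ∂μ).toNNReal := by
    have hA0 : 0 ≤ᵐ[μ] A n := by
      filter_upwards [ae_all_iff.2 ha0] with ω hω
      simpa only [hA, Finset.sum_apply, Pi.zero_apply] using Finset.sum_nonneg fun k _ ↦ hω k
    have hMA : A n - Y n ≤ᵐ[μ] A n := (hY0 n).mono fun ω hω ↦ sub_le_self _ hω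
    have hnorm := integral_norm_le_of_submartingale_of_le hM (hAint n) hA0 hMA
    rw [eLpNorm_one_eq_lintegral_enorm,
      ← ofReal_integral_norm_eq_lintegral_enorm (hM.integrable n)]
    refine ENNReal.ofReal_le_ofReal ?_
    simp only [Finset.range_zero, Finset.sum_empty, zero_sub, Pi.neg_apply, integral_neg,
      sub_neg_eq_add] at hnorm
    linarith [hA_le n]
  filter_upwards [hM.exists_ae_tendsto_of_bdd hbdd, ae_summable_of_summable_integral haint ha0 hsum]
    with ω ⟨l, hl⟩ hω
  refine ⟨_, (hω.hasSum.tendsto_sum_nat.sub hl).congr fun n ↦ ?_⟩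
  simp only [Pi.sub_apply, Finset.sum_apply, sub_sub_cancel]

theorem ae_isBigO_of_condExp_succ_le {ℱ : Filtration ℕ mΩ} {Y a : ℕ → Ω → ℝ} {L : ℕ → ℝ}
    (hY : StronglyAdapted ℱ Y) (ha : StronglyAdapted ℱ a)
    (hYint : ∀ n, Integrable (Y n) μ) (haint : ∀ n, Integrable (a n) μ)
    (hY0 : ∀ n, 0 ≤ᵐ[μ] Y n) (ha0 : ∀ n, 0 ≤ᵐ[μ] a n)
    (hle : ∀ n, μ[Y (n + 1) | ℱ n] ≤ᵐ[μ] Y n + a n)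
    (hL : Monotone L) (hL0 : ∀ n, 0 < L n) (hsum : Summable fun n ↦ (∫ ω, a n ω ∂μ) / L n) :
    ∀ᵐ ω ∂μ, (fun n ↦ Y n ω) =O[atTop] L := by
  have hstep (n : ℕ) : μ[(L (n + 1))⁻¹ • Y (n + 1) | ℱ n] ≤ᵐ[μ] (L n)⁻¹ • Y n + (L n)⁻¹ • a n := by
    filter_upwards [condExp_smul (L (n + 1))⁻¹ (Y (n + 1)) (ℱ n) (μ := μ), hle n, hY0 n, ha0 n]
      with ω hsmul hω hYω haω
    simp only [Pi.smul_apply, Pi.add_apply, Pi.zero_apply, smul_eq_mul] at hsmul hω hYω haω ⊢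
    rw [hsmul, ← mul_add]
    exact (mul_le_mul_of_nonneg_left hω (inv_nonneg.2 (hL0 _).le)).trans
      (mul_le_mul_of_nonneg_right (inv_anti₀ (hL0 n) (hL n.le_succ)) (add_nonneg hYω haω))
  have hsmul0 {f : ℕ → Ω → ℝ} (hf : ∀ n, 0 ≤ᵐ[μ] f n) (n : ℕ) : 0 ≤ᵐ[μ] (L n)⁻¹ • f n := by
    filter_upwards [hf n] with ω hω using mul_nonneg (inv_nonneg.2 (hL0 n).le) hω
  have hlim := exists_ae_tendsto_of_condExp_succ_le (ℱ := ℱ) (μ := μ)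
    (Y := fun n ↦ (L n)⁻¹ • Y n) (a := fun n ↦ (L n)⁻¹ • a n)
    (fun n ↦ (hY n).const_smul _) (fun n ↦ (ha n).const_smul _)
    (fun n ↦ (hYint n).smul _) (fun n ↦ (haint n).smul _) (hsmul0 hY0) (hsmul0 ha0) hstep
    (by simpa only [Pi.smul_apply, smul_eq_mul, integral_const_mul, div_eq_inv_mul] using hsum)
  filter_upwards [hlim] with ω ⟨l, hl⟩
  refine isBigO_of_div_tendsto_nhds (.of_forall fun n hn ↦ absurd hn (hL0 n).ne') l
    (hl.congr fun n ↦ ?_)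
  simp only [Pi.smul_apply, smul_eq_mul, Pi.div_apply, div_eq_inv_mul]

end RobbinsSiegmund

section SequenceSpace

variable {X : ℕ → Type*} [∀ n, MeasurableSpace (X n)] {ν : (n : ℕ) → Measure (X n)}
  [∀ n, IsProbabilityMeasure (ν n)] [∀ n, Finite (X n)] [∀ n, MeasurableSingletonClass (X n)]

theorem condExp_pastFiltration_ae_eq_integral_update {f : (∀ n, X n) → ℝ} {n : ℕ}
    (hf : DependsOn f (Set.Iio (n + 1))) :
    (Measure.infinitePi ν)[f | pastFiltration X n] =ᵐ[Measure.infinitePi ν]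
      fun c ↦ ∫ x, f (Function.update c n x) ∂ν n := by
  have hmeas := stronglyMeasurable_pastFiltration_of_dependsOn hf
  refine condExp_piFinset_ae_eq_integral_update ν Finset.notMem_range_self ?_
    (integrable_of_dependsOn hf)
  rw [← Finset.range_add_one]
  exact hmeas

variable {Y a : ℕ → (∀ n, X n) → ℝ}

theorem condExp_pastFiltration_succ_le (hY : ∀ n, DependsOn (Y n) (Set.Iio n)) {n : ℕ}
    (hle : ∀ c, ∫ x, Y (n + 1) (Function.update c n x) ∂ν n ≤ Y n c + a n c) :
    (Measure.infinitePi ν)[Y (n + 1) | pastFiltration X n] ≤ᵐ[Measure.infinitePi ν]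
      Y n + a n :=
  (condExp_pastFiltration_ae_eq_integral_update (hY (n + 1))).le.trans (.of_forall hle)

theorem integral_infinitePi_succ_le (hY : ∀ n, DependsOn (Y n) (Set.Iio n))
    (ha : ∀ n, DependsOn (a n) (Set.Iio n)) {n : ℕ}
    (hle : ∀ c, ∫ x, Y (n + 1) (Function.update c n x) ∂ν n ≤ Y n c + a n c) :
    ∫ c, Y (n + 1) c ∂Measure.infinitePi ν ≤
      ∫ c, Y n c ∂Measure.infinitePi ν + ∫ c, a n c ∂Measure.infinitePi ν := by
  rw [← integral_condExp ((pastFiltration X).le n),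
    ← integral_add (integrable_of_dependsOn (hY n)) (integrable_of_dependsOn (ha n))]
  exact integral_mono_ae integrable_condExp
    ((integrable_of_dependsOn (hY n)).add (integrable_of_dependsOn (ha n)))
    (condExp_pastFiltration_succ_le hY hle)

theorem ae_isBigO_of_integral_update_le {L : ℕ → ℝ} (hY : ∀ n, DependsOn (Y n) (Set.Iio n))
    (ha : ∀ n, DependsOn (a n) (Set.Iio n)) (hY0 : ∀ n c, 0 ≤ Y n c) (ha0 : ∀ n c, 0 ≤ a n c)
    (hle : ∀ n c, ∫ x, Y (n + 1) (Function.update c n x) ∂ν n ≤ Y n c + a n c)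
    (hL : Monotone L) (hL0 : ∀ n, 0 < L n)
    (hsum : Summable fun n ↦ (∫ c, a n c ∂Measure.infinitePi ν) / L n) :
    ∀ᵐ c ∂Measure.infinitePi ν, (fun n ↦ Y n c) =O[atTop] L :=
  ae_isBigO_of_condExp_succ_le (ℱ := pastFiltration X)
    (fun n ↦ stronglyMeasurable_pastFiltration_of_dependsOn (hY n))
    (fun n ↦ stronglyMeasurable_pastFiltration_of_dependsOn (ha n))
    (fun n ↦ integrable_of_dependsOn (hY n)) (fun n ↦ integrable_of_dependsOn (ha n))
    (fun n ↦ .of_forall (hY0 n)) (fun n ↦ .of_forall (ha0 n))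
    (fun n ↦ condExp_pastFiltration_succ_le hY (hle n)) hL hL0 hsum

end SequenceSpace

theorem integral_uniformOn_univ {α : Type*} [Fintype α] [Nonempty α] [MeasurableSpace α]
    [MeasurableSingletonClass α] (f : α → ℝ) :
    ∫ x, f x ∂uniformOn (Set.univ : Set α) = (∑ x, f x) / Fintype.card α := by
  rw [integral_fintype .of_finite, Finset.sum_div]
  refine Finset.sum_congr rfl fun x _ ↦ ?_
  rw [measureReal_def, uniformOn_univ, Measure.count_singleton, one_div, ENNReal.toReal_inv,
    ENNReal.toReal_natCast, smul_eq_mul, inv_mul_eq_div]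

namespace DupGraph

section Degrees

variable {V : Type*}

theorem sum_ncard_neighborSet_eq_two_mul_ncard_edgeSet {G : SimpleGraph V} {s : Finset V}
    (hG : G.support ⊆ s) : ∑ x ∈ s, (G.neighborSet x).ncard = 2 * G.edgeSet.ncard := by
  classical
  set H := G.induce (s : Set V) with hH
  have hdeg (x : s) : (G.neighborSet x).ncard = H.degree x := by
    have himage : G.neighborSet x = Subtype.val '' H.neighborSet x := by
      ext y
      simpa [hH] using fun h : G.Adj x y ↦ hG ⟨x, h.symm⟩
    rw [himage, Set.ncard_image_of_injective _ Subtype.val_injective,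
      ← SimpleGraph.card_neighborSet_eq_degree, Set.ncard_eq_toFinset_card', Set.toFinset_card]
  have hedges : G.edgeSet.ncard = H.edgeFinset.card := by
    conv_lhs => rw [← (G.spanningCoe_induce_eq_self _).2 hG, SimpleGraph.edgeSet_map,
      Set.ncard_image_of_injective _ (Function.Embedding.injective _)]
    rw [← hH, ← SimpleGraph.coe_edgeFinset, Set.ncard_coe_finset]
  rw [hedges, ← H.sum_degrees_eq_twice_card_edges, ← Finset.sum_coe_sort]
  exact Finset.sum_congr rfl fun x _ ↦ hdeg x

/-- The degree of a vertex, as a real number; it is `0` if the vertex has infinitely many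
neighbours. -/
noncomputable def deg (G : SimpleGraph V) (x : V) : ℝ := (G.neighborSet x).ncard

open scoped Classical in
/-- The adjacency matrix of `G` with ones on the diagonal: row `x` is the indicator of the closed
neighbourhood of `x`. -/
noncomputable def closedAdj (G : SimpleGraph V) (x y : V) : ℝ :=
  if y = x ∨ G.Adj x y then 1 else 0

open scoped Classical in
/-- The change of the sum of the squared degrees, up to terms linear in the degrees, if a copy of
`x` is added; deleting the edges of `x` changes it by the opposite amount. -/
noncomputable def degWeight (G : SimpleGraph V) (s : Finset V) (x : V) : ℝ :=
  deg G x ^ 2 + 2 * ∑ y ∈ s, deg G y * G.adjMatrix ℝ x y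

variable (G : SimpleGraph V)

theorem deg_nonneg (x : V) : 0 ≤ deg G x := Nat.cast_nonneg _

theorem closedAdj_nonneg (x y : V) : 0 ≤ closedAdj G x y := by
  unfold closedAdj
  split_ifs <;> norm_num

theorem closedAdj_sq (x y : V) : closedAdj G x y ^ 2 = closedAdj G x y := by
  unfold closedAdj
  split_ifs <;> norm_num

open scoped Classical in
theorem closedAdj_eq (x y : V) :
    closedAdj G x y = (if y = x then 1 else 0) + G.adjMatrix ℝ x y := by
  by_cases h : y = x <;> simp [closedAdj, h]

open scoped Classical in
theorem sum_deg_mul_closedAdj {s : Finset V} {x : V} (hx : x ∈ s) :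
    ∑ y ∈ s, deg G y * closedAdj G x y =
      deg G x + ∑ y ∈ s, deg G y * G.adjMatrix ℝ x y := by
  simp only [closedAdj_eq, mul_add, Finset.sum_add_distrib, mul_ite, mul_one, mul_zero,
    Finset.sum_ite_eq', hx, if_true]

variable {G} {s : Finset V} (hG : G.support ⊆ s)
include hG

theorem sum_deg : ∑ x ∈ s, deg G x = 2 * (G.edgeSet.ncard : ℝ) := by
  simp only [deg]
  exact_mod_cast sum_ncard_neighborSet_eq_two_mul_ncard_edgeSet hG

open scoped Classical in
theorem sum_adjMatrix (x : V) : ∑ y ∈ s, G.adjMatrix ℝ x y = deg G x := by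
  have hset : G.neighborSet x = {y ∈ s | G.Adj x y} := by
    ext y
    simpa using fun h : G.Adj x y ↦ hG ⟨x, h.symm⟩
  rw [deg, hset, Set.ncard_coe_finset]
  simp only [SimpleGraph.adjMatrix_apply, Finset.sum_boole]

theorem sum_closedAdj {x : V} (hx : x ∈ s) : ∑ y ∈ s, closedAdj G x y = 1 + deg G x := by
  classical
  simp only [closedAdj_eq, Finset.sum_add_distrib, Finset.sum_ite_eq', hx, if_true,
    sum_adjMatrix hG]

end Degrees

section OneStep

/-- One step of version 1: the vertex `u` is duplicated to the new vertex `a`, and then all edges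
of `v` except a possible edge to `a` are deleted. -/
def duplicateErase (G : SimpleGraph ℕ) (u v a : ℕ) : SimpleGraph ℕ :=
  (duplicate G u a).deleteEdges ((duplicate G u a).incidenceSet v \ {s(v, a)})

variable {G : SimpleGraph ℕ} {s : Finset ℕ} {u v a : ℕ}

theorem duplicate_adj_of_ne {x y : ℕ} (hx : x ≠ a) (hy : y ≠ a) :
    (duplicate G u a).Adj x y ↔ G.Adj x y := by
  simp [duplicate, hx, hy]

theorem duplicateErase_adj {x y : ℕ} : (duplicateErase G u v a).Adj x y ↔
    (duplicate G u a).Adj x y ∧ (x = v ∨ y = v → s(x, y) = s(v, a)) := by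
  simp only [duplicateErase, SimpleGraph.deleteEdges_adj, Set.mem_sdiff,
    SimpleGraph.mk'_mem_incidenceSet_iff, Set.mem_singleton_iff, eq_comm (a := v)]
  tauto

theorem duplicateErase_adj_of_ne {x y : ℕ} (hx : x ≠ a) (hy : y ≠ a) :
    (duplicateErase G u v a).Adj x y ↔ G.Adj x y ∧ x ≠ v ∧ y ≠ v := by
  rw [duplicateErase_adj, duplicate_adj_of_ne hx hy]
  grind

open scoped Classical in
theorem adjMatrix_duplicateErase_of_ne {x y : ℕ} (hx : x ≠ a) (hy : y ≠ a) :
    (duplicateErase G u v a).adjMatrix ℝ x y =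
      G.adjMatrix ℝ x y - (if y = v then G.adjMatrix ℝ v x else 0) -
        if x = v then G.adjMatrix ℝ v y else 0 := by
  simp only [SimpleGraph.adjMatrix_apply, duplicateErase_adj_of_ne hx hy]
  by_cases hxv : x = v <;> by_cases hyv : y = v <;> simp [hxv, hyv, G.adj_comm v]

variable (hG : G.support ⊆ s)
include hG

theorem support_duplicateErase_subset (hu : u ∈ s) :
    (duplicateErase G u v a).support ⊆ (insert a s : Finset ℕ) := by
  rintro x ⟨y, hxy⟩
  rw [Finset.mem_coe, Finset.mem_insert]
  by_contra! ⟨hxa, hxs⟩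
  have hxu : x ≠ u := fun h ↦ hxs (h ▸ hu)
  have hGx (z : ℕ) : ¬ G.Adj z x := fun h ↦ hxs (hG ⟨z, h.symm⟩)
  have hdup := (duplicateErase_adj.1 hxy).1
  simp [duplicate, hxa, hxu, hGx, G.adj_comm x] at hdup

variable (ha : a ∉ s) (hv : v ∈ s)
include ha hv

theorem duplicateErase_adj_new {x : ℕ} (hx : x ∈ s) :
    (duplicateErase G u v a).Adj x a ↔ x = u ∨ G.Adj u x := by
  have hxa : x ≠ a := ne_of_mem_of_not_mem hx ha
  have hva : v ≠ a := ne_of_mem_of_not_mem hv ha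
  have hGa (y : ℕ) : ¬ G.Adj y a := fun h ↦ ha (hG ⟨y, h.symm⟩)
  have hdup : (duplicate G u a).Adj x a ↔ x = u ∨ G.Adj u x := by
    simp [duplicate, hxa, hGa]
  rw [duplicateErase_adj, hdup, and_iff_left]
  rintro (rfl | rfl)
  · rfl
  · exact absurd rfl hva

open scoped Classical in
theorem adjMatrix_duplicateErase_new {x : ℕ} (hx : x ∈ s) :
    (duplicateErase G u v a).adjMatrix ℝ x a = closedAdj G u x := by
  simp only [SimpleGraph.adjMatrix_apply, closedAdj, duplicateErase_adj_new hG ha hv hx]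
  congr

variable (hu : u ∈ s)
include hu

theorem deg_duplicateErase_new : deg (duplicateErase G u v a) a = 1 + deg G u := by
  classical
  rw [← sum_adjMatrix (support_duplicateErase_subset hG hu), Finset.sum_insert ha,
    ← sum_closedAdj hG hu, SimpleGraph.adjMatrix_apply, if_neg (SimpleGraph.irrefl _), zero_add]
  refine Finset.sum_congr rfl fun x hx ↦ ?_
  rw [← adjMatrix_duplicateErase_new hG ha hv hx]
  exact (SimpleGraph.isSymm_adjMatrix _).apply _ _

open scoped Classical in
theorem deg_duplicateErase_of_mem {x : ℕ} (hx : x ∈ s) :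
    deg (duplicateErase G u v a) x =
      deg G x - G.adjMatrix ℝ v x - (if x = v then deg G v else 0) + closedAdj G u x := by
  have hold (y : ℕ) (hy : y ∈ s) := adjMatrix_duplicateErase_of_ne (G := G) (u := u) (v := v)
    (ne_of_mem_of_not_mem hx ha) (ne_of_mem_of_not_mem hy ha)
  rw [← sum_adjMatrix (support_duplicateErase_subset hG hu), Finset.sum_insert ha,
    adjMatrix_duplicateErase_new hG ha hv hx, Finset.sum_congr rfl hold, Finset.sum_sub_distrib,
    Finset.sum_sub_distrib, Finset.sum_ite_eq', if_pos hv, sum_adjMatrix hG, add_comm]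
  congr 2
  split_ifs
  · exact sum_adjMatrix hG v
  · exact Finset.sum_const_zero

theorem ncard_edgeSet_duplicateErase :
    ((duplicateErase G u v a).edgeSet.ncard : ℝ) =
      G.edgeSet.ncard + 1 + deg G u - deg G v := by
  have hsum := sum_deg (support_duplicateErase_subset hG hu (v := v) (a := a))
  rw [Finset.sum_insert ha, deg_duplicateErase_new hG ha hv hu,
    Finset.sum_congr rfl fun x ↦ deg_duplicateErase_of_mem hG ha hv hu, Finset.sum_add_distrib,
    Finset.sum_sub_distrib, Finset.sum_sub_distrib, Finset.sum_ite_eq', if_pos hv,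
    sum_adjMatrix hG, sum_closedAdj hG hu, sum_deg hG] at hsum
  linarith

open scoped Classical in
theorem sq_deg_duplicateErase_le {x : ℕ} (hx : x ∈ s) :
    deg (duplicateErase G u v a) x ^ 2 ≤
      deg G x ^ 2 - (if x = v then deg G v ^ 2 else 0) - 2 * (deg G x * G.adjMatrix ℝ v x) +
        2 * (deg G x * closedAdj G u x) + G.adjMatrix ℝ v x + closedAdj G u x := by
  have hclosed := closedAdj_sq G u x
  have hclosed0 := closedAdj_nonneg G u x
  have hdeg0 := mul_nonneg (deg_nonneg G x) hclosed0
  rw [deg_duplicateErase_of_mem hG ha hv hu hx]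
  by_cases hxv : x = v
  · simp only [hxv, SimpleGraph.adjMatrix_apply, SimpleGraph.irrefl, if_true, if_false] at *
    linarith
  · by_cases hadj : G.Adj v x <;>
      simp only [hxv, SimpleGraph.adjMatrix_apply, hadj, if_true, if_false] <;> linarith

open scoped Classical in
theorem sum_sq_deg_duplicateErase_le :
    ∑ x ∈ insert a s, deg (duplicateErase G u v a) x ^ 2 ≤
      ∑ x ∈ s, deg G x ^ 2 + degWeight G s u - degWeight G s v + 5 * deg G u + deg G v + 2 := by
  have hold : ∑ x ∈ s, deg (duplicateErase G u v a) x ^ 2 ≤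
      ∑ x ∈ s, deg G x ^ 2 - deg G v ^ 2 - 2 * ∑ x ∈ s, deg G x * G.adjMatrix ℝ v x +
        2 * (deg G u + ∑ x ∈ s, deg G x * G.adjMatrix ℝ u x) + deg G v + (1 + deg G u) := by
    refine (Finset.sum_le_sum fun x ↦ sq_deg_duplicateErase_le hG ha hv hu).trans_eq ?_
    rw [Finset.sum_add_distrib, Finset.sum_add_distrib, Finset.sum_add_distrib,
      Finset.sum_sub_distrib, Finset.sum_sub_distrib, Finset.sum_ite_eq', if_pos hv,
      ← Finset.mul_sum, ← Finset.mul_sum, sum_deg_mul_closedAdj G hu, sum_adjMatrix hG,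
      sum_closedAdj hG hu]
  rw [Finset.sum_insert ha, deg_duplicateErase_new hG ha hv hu]
  simp only [degWeight]
  linarith

end OneStep

section Trajectory

theorem version1_succ (c : Choices) (n : ℕ) :
    version1 c (n + 1) = duplicateErase (version1 c n) (c n).1 (c n).2 (n + 1) :=
  rfl

theorem support_version1_subset (c : Choices) (n : ℕ) :
    (version1 c n).support ⊆ Finset.range (n + 1) := by
  rintro x ⟨y, hxy⟩
  exact Finset.mem_coe.2 (Finset.mem_range_succ_iff.2 (le_of_version1_adj c n x y hxy).1)

theorem redVertices_subset_range (c : Choices) (n : ℕ) :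
    redVertices c n ⊆ Finset.range (n + 1) := by
  induction n with
  | zero => exact Finset.empty_subset _
  | succ n ih =>
    have hv := (c n).2.isLt
    intro x hx
    simp only [redVertices] at hx
    grind

theorem eq_or_adj_of_redEdges_adj_new {c : Choices} {n : ℕ}
    (h : (redEdges c (n + 1)).Adj (c n).2 (n + 1)) :
    ((c n).2 : ℕ) = (c n).1 ∨ (version1 c n).Adj (c n).1 (c n).2 :=
  (duplicateErase_adj_new (support_version1_subset c n) Finset.notMem_range_self
    (Finset.mem_range.2 (c n).2.isLt) (Finset.mem_range.2 (c n).2.isLt)).1 h.1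

open scoped Classical in
theorem numRed_succ_le (c : Choices) (n : ℕ) :
    (numRed c (n + 1) : ℝ) ≤ numRed c n + (if ((c n).1 : ℕ) ∈ redVertices c n then 1 else 0) -
      (if ((c n).2 : ℕ) ∈ redVertices c n then 1 else 0) +
        2 * closedAdj (version1 c n) (c n).1 (c n).2 := by
  have hnew : n + 1 ∉ redVertices c n := fun h ↦
    Finset.notMem_range_self (redVertices_subset_range c n h)
  have hvn : ((c n).2 : ℕ) ≠ n + 1 := (c n).2.isLt.ne
  set J := (redEdges c (n + 1)).Adj (c n).2 (n + 1) with hJ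
  have hJle : (if J then 1 else 0) ≤ closedAdj (version1 c n) (c n).1 (c n).2 := by
    by_cases h : J
    · simp [closedAdj, eq_or_adj_of_redEdges_adj_new h, h]
    · simpa only [h, if_false] using closedAdj_nonneg _ _ _
  have hcard : numRed c (n + 1) + (if ((c n).2 : ℕ) ∈ redVertices c n then 1 else 0) ≤
      numRed c n + (if ((c n).1 : ℕ) ∈ redVertices c n then 1 else 0) +
        2 * (if J then 1 else 0) := by
    simp only [numRed, redVertices, ← hJ]
    grind [Finset.erase_eq_of_notMem]
  have hcard' : (numRed c (n + 1) : ℝ) + (if ((c n).2 : ℕ) ∈ redVertices c n then 1 else 0) ≤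
      numRed c n + (if ((c n).1 : ℕ) ∈ redVertices c n then 1 else 0) +
        2 * (if J then 1 else 0) := mod_cast hcard
  linarith

theorem dependsOn_version1 (n : ℕ) : DependsOn (fun c ↦ version1 c n) (Set.Iio n) := by
  induction n with
  | zero => exact fun _ _ _ ↦ rfl
  | succ n ih =>
    intro c c' h
    simp only [version1, ih fun k hk ↦ h k (Nat.lt_succ_of_lt hk), h n n.lt_succ_self]

theorem dependsOn_version2 (n : ℕ) : DependsOn (fun c ↦ version2 c n) (Set.Iio n) := by
  induction n with
  | zero => exact fun _ _ _ ↦ rfl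
  | succ n ih =>
    intro c c' h
    simp only [version2, ih fun k hk ↦ h k (Nat.lt_succ_of_lt hk), h n n.lt_succ_self]

open scoped Classical in
theorem dependsOn_redVertices (n : ℕ) : DependsOn (fun c ↦ redVertices c n) (Set.Iio n) := by
  induction n with
  | zero => exact fun _ _ _ ↦ rfl
  | succ n ih =>
    intro c c' h
    have hred : redEdges c (n + 1) = redEdges c' (n + 1) :=
      congrArg₂ (· \ ·) (dependsOn_version1 (n + 1) h) (dependsOn_version2 (n + 1) h)
    have hstep : c n = c' n := h n n.lt_succ_self
    simp only [redVertices, ih fun k hk ↦ h k (Nat.lt_succ_of_lt hk), hstep]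
    exact if_congr (by rw [hred]) rfl rfl

theorem dependsOn_numEdges (n : ℕ) : DependsOn (fun c ↦ numEdges c n) (Set.Iio n) :=
  fun _ _ h ↦ congrArg (fun G ↦ G.edgeSet.ncard) (dependsOn_version1 n h)

theorem dependsOn_numRed (n : ℕ) : DependsOn (fun c ↦ numRed c n) (Set.Iio n) :=
  fun _ _ h ↦ congrArg Finset.card (dependsOn_redVertices n h)

/-- The sum of the squared degrees of version 1 after `n` steps. -/
noncomputable def sumSqDeg (c : Choices) (n : ℕ) : ℝ :=
  ∑ x ∈ Finset.range (n + 1), deg (version1 c n) x ^ 2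

theorem sumSqDeg_nonneg (c : Choices) (n : ℕ) : 0 ≤ sumSqDeg c n :=
  Finset.sum_nonneg fun _ _ ↦ sq_nonneg _

theorem dependsOn_sumSqDeg (n : ℕ) : DependsOn (fun c ↦ sumSqDeg c n) (Set.Iio n) :=
  fun _ _ h ↦ congrArg (fun G ↦ ∑ x ∈ Finset.range (n + 1), deg G x ^ 2) (dependsOn_version1 n h)

theorem numEdges_succ (c : Choices) (n : ℕ) :
    (numEdges c (n + 1) : ℝ) =
      numEdges c n + 1 + deg (version1 c n) (c n).1 - deg (version1 c n) (c n).2 := by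
  rw [numEdges, version1_succ]
  exact ncard_edgeSet_duplicateErase (support_version1_subset c n) Finset.notMem_range_self
    (Finset.mem_range.2 (c n).2.isLt) (Finset.mem_range.2 (c n).1.isLt)

theorem sumSqDeg_succ_le (c : Choices) (n : ℕ) :
    sumSqDeg c (n + 1) ≤ sumSqDeg c n +
      degWeight (version1 c n) (Finset.range (n + 1)) (c n).1 -
      degWeight (version1 c n) (Finset.range (n + 1)) (c n).2 +
      5 * deg (version1 c n) (c n).1 + deg (version1 c n) (c n).2 + 2 := by
  rw [sumSqDeg, version1_succ, Finset.range_add_one]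
  exact sum_sq_deg_duplicateErase_le (support_version1_subset c n) Finset.notMem_range_self
    (Finset.mem_range.2 (c n).2.isLt) (Finset.mem_range.2 (c n).1.isLt)

end Trajectory

section Law

/-- The law of the two vertices selected in step `n + 1`. -/
noncomputable def stepLaw (n : ℕ) : Measure (Fin (n + 1) × Fin (n + 1)) :=
  (uniformOn Set.univ).prod (uniformOn Set.univ)

instance (n : ℕ) : IsProbabilityMeasure (stepLaw n) :=
  inferInstanceAs (IsProbabilityMeasure ((uniformOn _).prod (uniformOn _)))

/-- The law of the sequence of all selected vertices. -/
noncomputable def choiceLaw : Measure Choices := Measure.infinitePi stepLaw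

instance : IsProbabilityMeasure choiceLaw :=
  inferInstanceAs (IsProbabilityMeasure (Measure.infinitePi stepLaw))

theorem IsUniformChoice.map_eq_choiceLaw {Ω : Type*} [MeasurableSpace Ω] {μ : Measure Ω}
    {c : (n : ℕ) → Ω → Fin (n + 1) × Fin (n + 1)} (hc : IsUniformChoice μ c) :
    μ.map (fun ω k ↦ c k ω) = choiceLaw := by
  rw [hc.indep.map_fun_eq_infinitePi_map hc.measurable, choiceLaw]
  exact congrArg Measure.infinitePi (funext hc.law)

theorem IsUniformChoice.ae_of_ae_choiceLaw {Ω : Type*} [MeasurableSpace Ω] {μ : Measure Ω}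
    {c : (n : ℕ) → Ω → Fin (n + 1) × Fin (n + 1)} (hc : IsUniformChoice μ c) {p : Choices → Prop}
    (hp : ∀ᵐ c' ∂choiceLaw, p c') : ∀ᵐ ω ∂μ, p fun k ↦ c k ω := by
  rw [← hc.map_eq_choiceLaw] at hp
  exact ae_of_ae_map (measurable_pi_lambda _ hc.measurable).aemeasurable hp

theorem integral_stepLaw (n : ℕ) (F : ℕ → ℕ → ℝ) :
    ∫ p, F p.1 p.2 ∂stepLaw n =
      (∑ x ∈ Finset.range (n + 1), ∑ y ∈ Finset.range (n + 1), F x y) / ((n : ℝ) + 1) ^ 2 := by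
  rw [stepLaw, integral_prod _ .of_finite]
  simp only [integral_uniformOn_univ, Fintype.card_fin, ← Finset.sum_div,
    fun x : Fin (n + 1) ↦ Fin.sum_univ_eq_sum_range (F x) (n + 1)]
  rw [Fin.sum_univ_eq_sum_range (fun x ↦ ∑ y ∈ Finset.range (n + 1), F x y), div_div, sq]
  push_cast
  rfl

theorem integral_stepLaw_add (n : ℕ) (f g : ℕ → ℝ) :
    ∫ p, (f p.1 + g p.2) ∂stepLaw n =
      (∑ x ∈ Finset.range (n + 1), f x + ∑ x ∈ Finset.range (n + 1), g x) / ((n : ℝ) + 1) := by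
  rw [integral_stepLaw n fun x y ↦ f x + g y]
  simp only [Finset.sum_add_distrib, Finset.sum_const, Finset.card_range, nsmul_eq_mul,
    ← Finset.mul_sum]
  push_cast
  field_simp

end Law

section Drift

variable (c : Choices) (n : ℕ)

theorem version1_update (p : Fin (n + 1) × Fin (n + 1)) :
    version1 (Function.update c n p) n = version1 c n :=
  dependsOn_version1 n fun _ hk ↦ Function.update_of_ne (ne_of_lt hk) _ _

theorem sum_deg_version1 :
    ∑ x ∈ Finset.range (n + 1), deg (version1 c n) x = 2 * (numEdges c n : ℝ) :=
  sum_deg (support_version1_subset c n)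

theorem numEdges_update_succ (p : Fin (n + 1) × Fin (n + 1)) :
    (numEdges (Function.update c n p) (n + 1) : ℝ) =
      numEdges c n + 1 + deg (version1 c n) p.1 - deg (version1 c n) p.2 := by
  rw [numEdges_succ, Function.update_self, numEdges, version1_update, numEdges]

theorem integral_numEdges_update_succ :
    ∫ p, (numEdges (Function.update c n p) (n + 1) : ℝ) ∂stepLaw n = numEdges c n + 1 := by
  have hsplit (p : Fin (n + 1) × Fin (n + 1)) :
      (numEdges (Function.update c n p) (n + 1) : ℝ) =
        (numEdges c n + 1 + deg (version1 c n) p.1) + -deg (version1 c n) p.2 := by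
    rw [numEdges_update_succ, sub_eq_add_neg]
  simp only [hsplit]
  rw [integral_stepLaw_add n (fun x ↦ numEdges c n + 1 + deg (version1 c n) x)
    (fun x ↦ -deg (version1 c n) x), Finset.sum_add_distrib, Finset.sum_neg_distrib,
    add_neg_cancel_right, Finset.sum_const, Finset.card_range, nsmul_eq_mul]
  push_cast
  field_simp

theorem integral_sq_numEdges_update_succ_le :
    ∫ p, ((numEdges (Function.update c n p) (n + 1) : ℝ) - (n + 1 : ℕ)) ^ 2 ∂stepLaw n ≤
      ((numEdges c n : ℝ) - n) ^ 2 + 4 * sumSqDeg c n / (n + 1) := by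
  set d := deg (version1 c n)
  set b := (numEdges c n : ℝ) - n
  -- `(b + d u - d v) ^ 2 ≤ b ^ 2 + 2 b (d u - d v) + 2 (d u ^ 2 + d v ^ 2)`
  have hle (p : Fin (n + 1) × Fin (n + 1)) :
      ((numEdges (Function.update c n p) (n + 1) : ℝ) - (n + 1 : ℕ)) ^ 2 ≤
        (b ^ 2 + 2 * b * d p.1 + 2 * d p.1 ^ 2) + (-(2 * b * d p.2) + 2 * d p.2 ^ 2) := by
    rw [numEdges_update_succ]
    push_cast
    linarith [sq_nonneg (d p.1 + d p.2)]
  refine (integral_mono .of_finite .of_finite hle).trans_eq ?_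
  rw [integral_stepLaw_add n (fun x ↦ b ^ 2 + 2 * b * d x + 2 * d x ^ 2)
    (fun x ↦ -(2 * b * d x) + 2 * d x ^ 2), div_eq_iff (by positivity), add_mul,
    div_mul_cancel₀ _ (by positivity)]
  simp only [Finset.sum_add_distrib, Finset.sum_neg_distrib, ← Finset.mul_sum, Finset.sum_const,
    Finset.card_range, nsmul_eq_mul, sumSqDeg]
  push_cast
  ring

theorem integral_sumSqDeg_update_succ_le :
    ∫ p, sumSqDeg (Function.update c n p) (n + 1) ∂stepLaw n ≤
      sumSqDeg c n + (2 + 12 * numEdges c n / (n + 1)) := by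
  set d := deg (version1 c n)
  set w := degWeight (version1 c n) (Finset.range (n + 1))
  have hle (p : Fin (n + 1) × Fin (n + 1)) : sumSqDeg (Function.update c n p) (n + 1) ≤
      (sumSqDeg c n + 2 + w p.1 + 5 * d p.1) + (-w p.2 + d p.2) := by
    have hsucc := sumSqDeg_succ_le (Function.update c n p) n
    rw [Function.update_self, sumSqDeg.eq_def _ n, version1_update, ← sumSqDeg.eq_def] at hsucc
    linarith
  refine (integral_mono .of_finite .of_finite hle).trans_eq ?_
  rw [integral_stepLaw_add n (fun x ↦ sumSqDeg c n + 2 + w x + 5 * d x)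
    (fun x ↦ -w x + d x), div_eq_iff (by positivity), add_mul, add_mul,
    div_mul_cancel₀ _ (by positivity)]
  simp only [Finset.sum_add_distrib, Finset.sum_neg_distrib, ← Finset.mul_sum, Finset.sum_const,
    Finset.card_range, nsmul_eq_mul, d, sum_deg_version1]
  push_cast
  ring

open scoped Classical in
theorem integral_numRed_update_succ_le :
    ∫ p, (numRed (Function.update c n p) (n + 1) : ℝ) ∂stepLaw n ≤
      numRed c n + 2 * (n + 1 + 2 * numEdges c n) / ((n : ℝ) + 1) ^ 2 := by
  set r : ℕ → ℝ := fun x ↦ if x ∈ redVertices c n then 1 else 0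
  have hle (p : Fin (n + 1) × Fin (n + 1)) : (numRed (Function.update c n p) (n + 1) : ℝ) ≤
      ((numRed c n + r p.1) + -r p.2) + 2 * closedAdj (version1 c n) p.1 p.2 := by
    have hsucc := numRed_succ_le (Function.update c n p) n
    have hred : redVertices (Function.update c n p) n = redVertices c n :=
      dependsOn_redVertices n fun _ hk ↦ Function.update_of_ne (ne_of_lt hk) _ _
    rw [Function.update_self, numRed.eq_def _ n, hred, version1_update] at hsucc
    exact hsucc
  have hclosed : ∑ x ∈ Finset.range (n + 1), ∑ y ∈ Finset.range (n + 1),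
      closedAdj (version1 c n) x y = n + 1 + 2 * numEdges c n := by
    rw [Finset.sum_congr rfl fun x ↦ sum_closedAdj (support_version1_subset c n),
      Finset.sum_add_distrib, sum_deg_version1]
    simp
  refine (integral_mono .of_finite .of_finite hle).trans_eq ?_
  rw [integral_add .of_finite .of_finite, integral_const_mul,
    integral_stepLaw_add n (fun x ↦ numRed c n + r x) (fun x ↦ -r x),
    integral_stepLaw n fun x y ↦ closedAdj (version1 c n) x y, hclosed, Finset.sum_add_distrib,
    Finset.sum_neg_distrib, add_neg_cancel_right, Finset.sum_const, Finset.card_range,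
    nsmul_eq_mul, mul_div_assoc]
  push_cast
  field_simp

end Drift

section Growth

theorem integrable_numEdges (n : ℕ) : Integrable (fun c ↦ (numEdges c n : ℝ)) choiceLaw :=
  integrable_of_dependsOn fun _ _ h ↦ congrArg Nat.cast (dependsOn_numEdges n h)

theorem integral_numEdges_le (n : ℕ) : ∫ c, (numEdges c n : ℝ) ∂choiceLaw ≤ n := by
  induction n with
  | zero => simp [numEdges, version1]
  | succ n ih =>
    have hstep : ∫ c, (numEdges c (n + 1) : ℝ) ∂choiceLaw ≤
        ∫ c, (numEdges c n : ℝ) ∂choiceLaw + ∫ _, (1 : ℝ) ∂choiceLaw :=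
      integral_infinitePi_succ_le (Y := fun n c ↦ (numEdges c n : ℝ)) (a := fun _ _ ↦ 1)
        (fun n _ _ h ↦ congrArg Nat.cast (dependsOn_numEdges n h)) (fun _ _ _ _ ↦ rfl)
        fun c ↦ (integral_numEdges_update_succ c n).le
    rw [integral_const, probReal_univ, one_smul] at hstep
    push_cast
    linarith

theorem integral_sumSqDeg_le (n : ℕ) : ∫ c, sumSqDeg c n ∂choiceLaw ≤ 14 * n := by
  induction n with
  | zero => simp [sumSqDeg, version1, deg, SimpleGraph.neighborSet]
  | succ n ih =>
    have hstep : ∫ c, sumSqDeg c (n + 1) ∂choiceLaw ≤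
        ∫ c, sumSqDeg c n ∂choiceLaw +
          ∫ c, (2 + 12 * numEdges c n / ((n : ℝ) + 1)) ∂choiceLaw :=
      integral_infinitePi_succ_le (Y := fun n c ↦ sumSqDeg c n) dependsOn_sumSqDeg
        (fun n _ _ h ↦ congrArg (fun k : ℕ ↦ 2 + 12 * k / ((n : ℝ) + 1)) (dependsOn_numEdges n h))
        (integral_sumSqDeg_update_succ_le · n)
    have hdrift : ∫ c, (12 * numEdges c n / ((n : ℝ) + 1)) ∂choiceLaw ≤ 12 := by
      rw [integral_div, integral_const_mul, div_le_iff₀ (by positivity)]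
      linarith [integral_numEdges_le n]
    rw [integral_add (integrable_const _) (((integrable_numEdges n).const_mul 12).div_const _),
      integral_const, probReal_univ, one_smul] at hstep
    push_cast
    linarith

theorem ae_isBigO_sq_numEdges_sub :
    ∀ᵐ c ∂choiceLaw, (fun n ↦ ((numEdges c n : ℝ) - n) ^ 2) =O[atTop]
      fun n : ℕ ↦ ((n : ℝ) + 1) ^ (3 / 2 : ℝ) := by
  refine ae_isBigO_of_integral_update_le (a := fun n c ↦ 4 * sumSqDeg c n / (n + 1))
    (fun n _ _ h ↦ congrArg (fun k : ℕ ↦ ((k : ℝ) - n) ^ 2) (dependsOn_numEdges n h))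
    (fun n _ _ h ↦ congrArg (fun q : ℝ ↦ 4 * q / (n + 1)) (dependsOn_sumSqDeg n h))
    (fun _ _ ↦ sq_nonneg _) (fun n c ↦ ?_)
    (fun n c ↦ integral_sq_numEdges_update_succ_le c n)
    (monotone_nat_of_le_succ fun n ↦ ?_) (fun n ↦ by positivity) ?_
  · have := sumSqDeg_nonneg c n
    positivity
  · push_cast
    gcongr
    linarith
  · have hseries := ((summable_nat_add_iff 1).2
      (Real.summable_one_div_nat_rpow.2 (by norm_num : (1 : ℝ) < 3 / 2))).mul_left 56
    refine hseries.of_nonneg_of_le (fun n ↦ ?_) fun n ↦ ?_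
    · exact div_nonneg (integral_nonneg fun c ↦ div_nonneg
        (mul_nonneg zero_le_four (sumSqDeg_nonneg c n)) (by positivity)) (by positivity)
    · rw [integral_div, integral_const_mul, ← mul_one_div, Nat.cast_succ]
      have hmean : ∫ c, sumSqDeg c n ∂Measure.infinitePi stepLaw ≤ 14 * n :=
        integral_sumSqDeg_le n
      gcongr
      rw [div_le_iff₀ (by positivity)]
      linarith

theorem ae_isEquivalent_numEdges :
    ∀ᵐ c ∂choiceLaw, (fun n ↦ (numEdges c n : ℝ)) ~[atTop] fun n ↦ (n : ℝ) := by
  filter_upwards [ae_isBigO_sq_numEdges_sub] with c hc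
  exact isEquivalent_natCast_of_isBigO_sq_sub (by norm_num) hc

theorem integral_numRed_drift_le (n : ℕ) :
    ∫ c, 2 * (n + 1 + 2 * numEdges c n) / ((n : ℝ) + 1) ^ 2 ∂choiceLaw ≤ 6 / ((n : ℝ) + 1) := by
  rw [integral_div, integral_const_mul, integral_add (integrable_const _)
    ((integrable_numEdges n).const_mul 2), integral_const, probReal_univ, one_smul,
    integral_const_mul, div_le_div_iff₀ (by positivity) (by positivity)]
  nlinarith [integral_numEdges_le n, n.cast_nonneg (α := ℝ)]

theorem ae_isBigO_numRed {p : ℝ} (hp : 1 < p) :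
    ∀ᵐ c ∂choiceLaw, (fun n ↦ (numRed c n : ℝ)) =O[atTop]
      fun n : ℕ ↦ Real.log (n + 3) ^ p := by
  have hlog (n : ℕ) : 0 < Real.log (n + 3) := log_natCast_add_pos (by norm_num) n
  refine ae_isBigO_of_integral_update_le
    (a := fun n c ↦ 2 * (n + 1 + 2 * numEdges c n) / ((n : ℝ) + 1) ^ 2)
    (fun n _ _ h ↦ congrArg Nat.cast (dependsOn_numRed n h))
    (fun n _ _ h ↦ congrArg (fun k : ℕ ↦ 2 * (n + 1 + 2 * k) / ((n : ℝ) + 1) ^ 2)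
      (dependsOn_numEdges n h))
    (fun _ _ ↦ Nat.cast_nonneg _) (fun n c ↦ by positivity)
    (fun n c ↦ integral_numRed_update_succ_le c n)
    (monotone_nat_of_le_succ fun n ↦ ?_) (fun n ↦ Real.rpow_pos_of_pos (hlog n) p) ?_
  · have := (hlog n).le
    push_cast
    gcongr
    linarith
  · have hseries := ((summable_nat_add_iff 1).2 (summable_one_div_mul_log_rpow hp)).mul_left 6
    refine hseries.of_nonneg_of_le (fun n ↦ ?_) fun n ↦ ?_
    · have := hlog n
      exact div_nonneg (integral_nonneg fun c ↦ by positivity) (by positivity)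
    · have hshift : ((n + 1 : ℕ) : ℝ) + 2 = n + 3 := by push_cast; ring
      have := hlog n
      rw [hshift, Nat.cast_succ, ← div_div, mul_div_assoc', mul_one_div]
      gcongr
      exact integral_numRed_drift_le n

theorem ae_forall_isBigO_numRed :
    ∀ᵐ c ∂choiceLaw, ∀ ε : ℝ, 0 < ε →
      (fun n ↦ (numRed c n : ℝ)) =O[atTop] fun n : ℕ ↦ Real.log n ^ (1 + ε) := by
  have hae : ∀ᵐ c ∂choiceLaw, ∀ k : ℕ, (fun n ↦ (numRed c n : ℝ)) =O[atTop]
      fun n : ℕ ↦ Real.log (n + 3) ^ (1 + 1 / ((k : ℝ) + 1)) :=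
    ae_all_iff.2 fun k ↦ ae_isBigO_numRed (lt_add_of_pos_right 1 (by positivity))
  filter_upwards [hae] with c hc ε hε
  obtain ⟨k, hk⟩ := exists_nat_one_div_lt hε
  exact (hc k).trans (isBigO_log_natCast_add_rpow 3 (by positivity) (by linarith))

end Growth

end DupGraph

theorem mainTheorem5 {Ω : Type*} [MeasurableSpace Ω] (μ : Measure Ω) [IsProbabilityMeasure μ]
    (c : (n : ℕ) → Ω → Fin (n + 1) × Fin (n + 1)) (hc : DupGraph.IsUniformChoice μ c) :
    ∀ᵐ ω ∂μ,
      ((fun n : ℕ => (DupGraph.numEdges (fun k => c k ω) n : ℝ)) ~[atTop] fun n : ℕ => (n : ℝ)) ∧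
      ∀ ε : ℝ, 0 < ε →
        (fun n : ℕ => (DupGraph.numRed (fun k => c k ω) n : ℝ)) =O[atTop]
          fun n : ℕ => Real.log (n : ℝ) ^ (1 + ε) := by
  exact hc.ae_of_ae_choiceLaw
    (DupGraph.ae_isEquivalent_numEdges.and DupGraph.ae_forall_isBigO_numRed)
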